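/- Let $\mathbb{K}$ be an algebraically closed field of characteristic zero and let $N=2m\ge 2$ be an even integer. Let $A_N=\mathbb{K}[t_1^{\pm1},\dots,t_N^{\pm1}]$, let $d_i=t_i\frac{\partial}{\partial t_i}$, and for $u\in\mathbb{K}^N$ and $r\in\mathbb{Z}^N$ let $D(u,r)=\sum_{i=1}^N u_i t^{r} d_i$, an element of the Lie algebra $\operatorname{Der}_{\mathbb K}(A_N)$ of all $\mathbb{K}$-linear derivations of $A_N$. For $r=(r_1,\dots,r_{2m})\in\mathbb{Z}^N$ put $\overline{r}=(r_{m+1},\dots,r_{2m},-r_1,\dots,-r_m)$ and $h_r=D(\overline r,r)$. Let $\mathfrak{h}=\{D(u,0)\mid u\in\mathbb{K}^N\}$, let $$\mathcal{H}_N=\operatorname{span}_{\mathbb{K}}\{h_r\mid r\in\mathbb{Z}^N\}+\mathfrak{h}\subseteq\operatorname{Der}_{\mathbb K}(A_N)$$ be the Hamiltonian Lie algebra, and let $\mathcal{H}_N'=[\mathcal{H}_N,\mathcal{H}_N]$. For a Lie algebra $\mathfrak g$ over $\mathbb K$, let $\operatorname{Der}(\mathfrak g)$ be the Lie algebra of its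 $\mathbb{K}$-linear derivations. Theorem 4.6 (Theorem B). Every derivation of $\mathcal{H}_N$ is inner and the center of $\mathcal{H}_N$ is zero, that is, $\mathcal{H}_N$ is complete. The map $x\mapsto\operatorname{ad}x$ is an isomorphism of Lie algebras $\mathcal{H}_N\cong\operatorname{Der}(\mathcal{H}_N)$. Moreover, restriction to $\mathcal{H}_N'$ is an isomorphism of Lie algebras $\operatorname{Der}(\mathcal{H}_N)\cong\operatorname{Der}(\mathcal{H}_N')$. -/

import Mathlib

/-- The Laurent polynomial algebra over `K` in commuting variables `t i`, `i : ι`, as the group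
algebra of `ℤ^ι`; the monomial `t^r` is `AddMonoidAlgebra.single r 1`. -/
abbrev LaurentAlg (K : Type*) [Field K] (ι : Type*) : Type _ :=
  AddMonoidAlgebra K (ι → ℤ)

/-- The Witt algebra: the Lie algebra of all derivations of the Laurent polynomial algebra. -/
abbrev WittAlg (K : Type*) [Field K] (ι : Type*) : Type _ :=
  Derivation K (LaurentAlg K ι) (LaurentAlg K ι)

/-- The linear map `t^n ↦ (n i) t^n`. -/
noncomputable def degreeMap (K : Type*) [Field K] {ι : Type*} (i : ι) :
    LaurentAlg K ι →ₗ[K] LaurentAlg K ι :=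
  Finsupp.lsum K (fun n : ι → ℤ => ((n i : ℤ) : K) • AddMonoidAlgebra.lsingle n) ∘ₗ
    (AddMonoidAlgebra.coeffLinearEquiv K).toLinearMap

theorem degreeMap_single (K : Type*) [Field K] {ι : Type*} (i : ι) (n : ι → ℤ) (a : K) :
    degreeMap K i (AddMonoidAlgebra.single n a) =
      AddMonoidAlgebra.single n (((n i : ℤ) : K) * a) := by
  simp [degreeMap]

/-- The degree derivation `d i = t i * ∂/∂(t i)` of the Laurent polynomial algebra. -/
noncomputable def degreeDer (K : Type*) [Field K] {ι : Type*} (i : ι) :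
    WittAlg K ι :=
  Derivation.mk' (degreeMap K i) (by
    intro a b
    induction a using AddMonoidAlgebra.induction_linear with
    | zero => simp
    | add f g hf hg => simp only [add_mul, map_add, add_smul, hf, hg, smul_add]; abel
    | single n x =>
      induction b using AddMonoidAlgebra.induction_linear with
      | zero => simp
      | add f g hf hg => simp only [mul_add, map_add, add_smul, hf, hg, smul_add]; abel
      | single k y =>
        simp only [AddMonoidAlgebra.single_mul_single, degreeMap_single, smul_eq_mul]
        rw [add_comm k n, ← AddMonoidAlgebra.single_add]
        congr 1
        simp only [Pi.add_apply]
        push_cast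
        ring)

/-- The vector field `D(u, r) = ∑ i, u i * t^r * d i`. -/
noncomputable def vectorField {K : Type*} [Field K] {ι : Type*} [Fintype ι]
    (u : ι → K) (r : ι → ℤ) : WittAlg K ι :=
  ∑ i, u i • ((AddMonoidAlgebra.single r (1 : K) : LaurentAlg K ι) • degreeDer K i)

/-- `D(u, r) (t^n) = (∑ i, u i * n i) t^(r + n)`. -/
theorem vectorField_single {K : Type*} [Field K] {ι : Type*} [Fintype ι]
    (u : ι → K) (r n : ι → ℤ) (a : K) :
    vectorField u r (AddMonoidAlgebra.single n a) =
      AddMonoidAlgebra.single (r + n) ((∑ i, u i * ((n i : ℤ) : K)) * a) := by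
  have h : ∀ i, degreeDer K i (AddMonoidAlgebra.single n a) =
      AddMonoidAlgebra.single n (((n i : ℤ) : K) * a) := fun i => degreeMap_single K i n a
  have h₂ : vectorField u r (AddMonoidAlgebra.single n a) =
      ∑ i, u i • ((AddMonoidAlgebra.single r (1 : K) : LaurentAlg K ι) •
        degreeDer K i (AddMonoidAlgebra.single n a)) := by
    rw [vectorField, ← Derivation.coeFnAddMonoidHom_apply, map_sum, Finset.sum_apply]
    rfl
  rw [h₂]
  simp only [h, smul_eq_mul, AddMonoidAlgebra.single_mul_single,
    AddMonoidAlgebra.smul_single, one_mul, Finset.sum_mul, mul_assoc]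
  exact (map_sum (AddMonoidAlgebra.singleAddHom (R := K) (r + n)) _ _).symm

theorem derivation_ext_single {K : Type*} [Field K] {ι : Type*}
    {D E : WittAlg K ι}
    (h : ∀ n : ι → ℤ, ∀ a : K, D (AddMonoidAlgebra.single n a) = E (AddMonoidAlgebra.single n a)) :
    D = E := by
  ext1 f
  induction f using AddMonoidAlgebra.induction_linear with
  | zero => simp
  | add f g hf hg => rw [map_add, map_add, hf, hg]
  | single n a => exact h n a

/-- `[D(u, r), D(v, s)] = D((u, s) v - (v, r) u, r + s)`. -/
theorem lie_vectorField {K : Type*} [Field K] {ι : Type*} [Fintype ι]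
    (u v : ι → K) (r s : ι → ℤ) :
    ⁅vectorField u r, vectorField v s⁆ =
      vectorField ((∑ i, u i * ((s i : ℤ) : K)) • v - (∑ i, v i * ((r i : ℤ) : K)) • u)
        (r + s) := by
  apply derivation_ext_single
  intro n a
  rw [Derivation.commutator_apply]
  simp only [vectorField_single]
  rw [show s + (r + n) = r + s + n by abel, ← add_assoc, ← AddMonoidAlgebra.single_sub]
  congr 1
  simp only [Pi.add_apply, Pi.sub_apply, Pi.smul_apply, smul_eq_mul, Int.cast_add, mul_add,
    sub_mul, Finset.sum_add_distrib, Finset.sum_sub_distrib, mul_assoc, ← Finset.mul_sum]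
  ring

/-- For `r = (r₁, …, r₂ₘ)`, with the `2m` coordinates split into two blocks of length `m`, the
vector `J r = (rₘ₊₁, …, r₂ₘ, -r₁, …, -rₘ)`. -/
def symplecticBar {m : ℕ} (r : Fin m ⊕ Fin m → ℤ) : Fin m ⊕ Fin m → ℤ :=
  Sum.elim (fun i => r (Sum.inr i)) (fun i => -r (Sum.inl i))

/-- The Hamiltonian vector field `h r = D(J r, r)` on the `2m`-dimensional torus. -/
noncomputable def hamVec (K : Type*) [Field K] {m : ℕ} (r : Fin m ⊕ Fin m → ℤ) :
    WittAlg K (Fin m ⊕ Fin m) :=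
  vectorField (fun i => ((symplecticBar r i : ℤ) : K)) r

/-- `[h r, h s] = (J r, s) h (r + s)`. -/
theorem lie_hamVec (K : Type*) [Field K] {m : ℕ} (r s : Fin m ⊕ Fin m → ℤ) :
    ⁅hamVec K r, hamVec K s⁆ =
      ((∑ i, symplecticBar r i * s i : ℤ) : K) • hamVec K (r + s) := by
  apply derivation_ext_single
  intro n a
  rw [hamVec, hamVec, lie_vectorField, Derivation.smul_apply, hamVec, vectorField_single,
    vectorField_single, AddMonoidAlgebra.smul_single, smul_eq_mul, ← mul_assoc]
  congr 2
  have h : ∑ i, ((symplecticBar s i : ℤ) : K) * ((r i : ℤ) : K) =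
      -∑ i, ((symplecticBar r i : ℤ) : K) * ((s i : ℤ) : K) := by
    simp only [symplecticBar, Fintype.sum_sum_type, Sum.elim_inl, Sum.elim_inr, Int.cast_neg,
      neg_mul, Finset.sum_neg_distrib, neg_add, neg_neg, mul_comm]
    rw [add_comm]
  simp only [h, Finset.mul_sum, Int.cast_sum, Int.cast_mul]
  simp only [← Finset.mul_sum]
  rw [Finset.mul_sum]
  apply Finset.sum_congr rfl
  rintro (i | i) - <;> simp [symplecticBar] <;> ring

/-- Elements of the Cartan subalgebra act diagonally: `[D(u, 0), h s] = (u, s) h s`. -/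
theorem lie_cartan_hamVec (K : Type*) [Field K] {m : ℕ} (u : Fin m ⊕ Fin m → K)
    (s : Fin m ⊕ Fin m → ℤ) :
    ⁅vectorField u 0, hamVec K s⁆ = (∑ i, u i * ((s i : ℤ) : K)) • hamVec K s := by
  apply derivation_ext_single
  intro n a
  rw [hamVec, lie_vectorField, Derivation.smul_apply, vectorField_single,
    vectorField_single, AddMonoidAlgebra.smul_single, smul_eq_mul, ← mul_assoc, zero_add]
  simp only [Pi.zero_apply, Int.cast_zero, mul_zero, Finset.sum_const_zero, zero_smul, sub_zero,
    Pi.smul_apply, smul_eq_mul, mul_assoc, Finset.mul_sum]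

/-- The generators of the Hamiltonian Lie algebra as a vector space: all `h r`, `r ∈ ℤ^(2m)`,
and the Cartan subalgebra `𝔥 = {D(u, 0) | u ∈ K^(2m)}`. -/
def hamSpanSet (K : Type*) [Field K] (m : ℕ) :
    Set (WittAlg K (Fin m ⊕ Fin m)) :=
  Set.range (fun r => hamVec K r) ∪ Set.range (fun u => vectorField u 0)

theorem lie_mem_span_hamSpanSet (K : Type*) [Field K] (m : ℕ) :
    ∀ x ∈ hamSpanSet K m, ∀ y ∈ hamSpanSet K m, ⁅x, y⁆ ∈ Submodule.span K (hamSpanSet K m) := by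
  have key : ∀ r, hamVec K r ∈ Submodule.span K (hamSpanSet K m) :=
    fun r => Submodule.subset_span (Or.inl ⟨r, rfl⟩)
  rintro x (⟨r, rfl⟩ | ⟨u, rfl⟩) y (⟨s, rfl⟩ | ⟨v, rfl⟩)
  · simp only [lie_hamVec]
    exact Submodule.smul_mem _ _ (key _)
  · rw [← lie_skew]
    simp only [lie_cartan_hamVec]
    exact Submodule.neg_mem _ (Submodule.smul_mem _ _ (key _))
  · simp only [lie_cartan_hamVec]
    exact Submodule.smul_mem _ _ (key _)
  · simp only [lie_vectorField, add_zero]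
    exact Submodule.subset_span (Or.inr ⟨_, rfl⟩)

/-- A linear span that contains all brackets of its generators, as a Lie subalgebra. -/
def spanLieSubalgebra {K L : Type*} [CommRing K] [LieRing L] [LieAlgebra K L] (S : Set L)
    (hS : ∀ x ∈ S, ∀ y ∈ S, ⁅x, y⁆ ∈ Submodule.span K S) : LieSubalgebra K L where
  toSubmodule := Submodule.span K S
  lie_mem' := by
    intro x y hx hy
    change x ∈ Submodule.span K S at hx
    change y ∈ Submodule.span K S at hy
    change ⁅x, y⁆ ∈ Submodule.span K S
    induction hx, hy using Submodule.span_induction₂ with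
    | mem_mem x y hx hy => exact hS x hx y hy
    | zero_left y hy => simp
    | zero_right x hx => simp
    | add_left x y z hx hy hz h₁ h₂ => rw [add_lie]; exact Submodule.add_mem _ h₁ h₂
    | add_right x y z hx hy hz h₁ h₂ => rw [lie_add]; exact Submodule.add_mem _ h₁ h₂
    | smul_left r x y hx hy h => rw [smul_lie]; exact Submodule.smul_mem _ _ h
    | smul_right r x y hx hy h => rw [lie_smul]; exact Submodule.smul_mem _ _ h

/-- The Hamiltonian Lie algebra `H_N`, `N = 2m`: the Lie subalgebra
`span {h r | r ∈ ℤ^N} + 𝔥` of the Witt algebra of all derivations of the Laurent polynomials. -/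
noncomputable def Ham (K : Type*) [Field K] (m : ℕ) :
    LieSubalgebra K (WittAlg K (Fin m ⊕ Fin m)) :=
  spanLieSubalgebra (hamSpanSet K m) (lie_mem_span_hamSpanSet K m)

/-- The derived subalgebra `H_N' = [H_N, H_N]`. -/
noncomputable abbrev HamDerived (K : Type*) [Field K] (m : ℕ) : LieIdeal K (Ham K m) :=
  ⁅(⊤ : LieIdeal K (Ham K m)), (⊤ : LieIdeal K (Ham K m))⁆

/-- The symplectic form `(J r, s)` on `ℤ^(2m)`. -/
def symplecticForm {m : ℕ} (r s : Fin m ⊕ Fin m → ℤ) : ℤ :=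
  ∑ i, symplecticBar r i * s i

section SymplecticForm

variable {m : ℕ} (r s t : Fin m ⊕ Fin m → ℤ)

theorem symplecticForm_eq :
    symplecticForm r s = ∑ i, (r (Sum.inr i) * s (Sum.inl i) - r (Sum.inl i) * s (Sum.inr i)) := by
  simp [symplecticForm, symplecticBar, sub_eq_add_neg, Finset.sum_add_distrib]

theorem symplecticForm_add_left :
    symplecticForm (r + s) t = symplecticForm r t + symplecticForm s t := by
  simp only [symplecticForm_eq, ← Finset.sum_add_distrib, Pi.add_apply]
  exact Finset.sum_congr rfl fun i _ => by ring

theorem symplecticForm_add_right :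
    symplecticForm r (s + t) = symplecticForm r s + symplecticForm r t := by
  simp only [symplecticForm, ← Finset.sum_add_distrib, Pi.add_apply, mul_add]

theorem symplecticForm_smul_left (k : ℤ) :
    symplecticForm (k • r) s = k * symplecticForm r s := by
  simp only [symplecticForm_eq, Finset.mul_sum, Pi.smul_apply, smul_eq_mul]
  exact Finset.sum_congr rfl fun i _ => by ring

theorem symplecticForm_smul_right (k : ℤ) :
    symplecticForm r (k • s) = k * symplecticForm r s := by
  simp only [symplecticForm_eq, Finset.mul_sum, Pi.smul_apply, smul_eq_mul]
  exact Finset.sum_congr rfl fun i _ => by ring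

@[simp]
theorem symplecticForm_self : symplecticForm r r = 0 := by
  rw [symplecticForm_eq]
  exact Finset.sum_eq_zero fun i _ => by ring

theorem symplecticForm_swap : symplecticForm s r = -symplecticForm r s := by
  simp only [symplecticForm_eq, ← Finset.sum_neg_distrib]
  exact Finset.sum_congr rfl fun i _ => by ring

@[simp]
theorem symplecticForm_zero_left : symplecticForm 0 s = 0 := by
  simp [symplecticForm_eq]

variable {r s t}

theorem symplecticForm_bar_ne_zero (hr : r ≠ 0) : symplecticForm r (symplecticBar r) ≠ 0 := by
  intro h
  apply hr
  have h₂ := (Finset.sum_eq_zero_iff_of_nonneg fun i _ => mul_self_nonneg (symplecticBar r i)).1 h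
  funext i
  rcases i with i | i
  · simpa [symplecticBar] using h₂ (Sum.inr i) (Finset.mem_univ _)
  · simpa [symplecticBar] using h₂ (Sum.inl i) (Finset.mem_univ _)

theorem exists_symplecticForm_ne_zero₂ (hr : r ≠ 0) (hs : s ≠ 0) :
    ∃ x, symplecticForm r x ≠ 0 ∧ symplecticForm s x ≠ 0 := by
  have h₁ := symplecticForm_bar_ne_zero hr
  have h₂ := symplecticForm_bar_ne_zero hs
  generalize symplecticBar r = x at h₁
  generalize symplecticBar s = y at h₂
  by_cases h₃ : symplecticForm s x = 0
  · by_cases h₄ : symplecticForm r y = 0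
    · exact ⟨x + y, by simp [symplecticForm_add_right, h₁, h₄],
        by simp [symplecticForm_add_right, h₂, h₃]⟩
    · exact ⟨y, h₄, h₂⟩
  · exact ⟨x, h₁, h₃⟩

theorem exists_symplecticForm_ne_zero₃ (hr : r ≠ 0) (hs : s ≠ 0) (ht : t ≠ 0) :
    ∃ x, symplecticForm r x ≠ 0 ∧ symplecticForm s x ≠ 0 ∧ symplecticForm t x ≠ 0 := by
  obtain ⟨x, h₁, h₂⟩ := exists_symplecticForm_ne_zero₂ hr hs
  have h₃ := symplecticForm_bar_ne_zero ht
  generalize symplecticBar t = y at h₃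
  by_cases h₄ : symplecticForm t x = 0
  · by_contra! h
    have k₁ := h ((1 : ℤ) • x + y)
    have k₂ := h ((2 : ℤ) • x + y)
    have k₃ := h ((3 : ℤ) • x + y)
    simp only [symplecticForm_add_right, symplecticForm_smul_right] at k₁ k₂ k₃
    omega
  · exact ⟨x, h₁, h₂, h₄⟩

end SymplecticForm

section FunctionalEquation

variable {K : Type*} [Field K] {m : ℕ}

/-- The functional equation satisfied by the coefficients of a homogeneous derivation of degree
`g` of the Lie algebra spanned by the Hamiltonian vector fields. -/
def IsHomogeneousCocycle (g : Fin m ⊕ Fin m → ℤ) (f : (Fin m ⊕ Fin m → ℤ) → K) : Prop :=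
  ∀ r s, (symplecticForm r s : K) * f (r + s) =
    (symplecticForm (r + g) s : K) * f r + (symplecticForm r (s + g) : K) * f s

variable {g : Fin m ⊕ Fin m → ℤ} {f : (Fin m ⊕ Fin m → ℤ) → K}

namespace IsHomogeneousCocycle

theorem apply_add (hf : IsHomogeneousCocycle g f) (r s : Fin m ⊕ Fin m → ℤ) :
    (symplecticForm r s : K) * f (r + s) =
      (symplecticForm r s + symplecticForm g s : K) * f r +
        (symplecticForm r s - symplecticForm g r : K) * f s := by
  rw [hf r s, symplecticForm_add_left, symplecticForm_add_right, symplecticForm_swap g r]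
  push_cast
  ring

theorem mul_comm_of_form_eq_zero (hf : IsHomogeneousCocycle g f) {r s : Fin m ⊕ Fin m → ℤ}
    (h : symplecticForm r s = 0) :
    (symplecticForm g s : K) * f r = (symplecticForm g r : K) * f s := by
  have := hf.apply_add r s
  rw [h] at this
  push_cast at this
  linear_combination -this

variable [CharZero K]

theorem apply_zsmul (hf : IsHomogeneousCocycle g f) {s : Fin m ⊕ Fin m → ℤ}
    (h : symplecticForm g s ≠ 0) (k : ℤ) : f (k • s) = k * f s := by
  have h₁ := hf.mul_comm_of_form_eq_zero (r := s) (s := k • s) (by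
    rw [symplecticForm_smul_right, symplecticForm_self, mul_zero])
  rw [symplecticForm_smul_right] at h₁
  have h₂ : (symplecticForm g s : K) ≠ 0 := by exact_mod_cast h
  apply mul_left_cancel₀ h₂
  push_cast at h₁
  linear_combination -h₁

theorem apply_eq_zero (hf : IsHomogeneousCocycle g f) (hg : g ≠ 0) (h₀ : f (-g) = 0)
    {r : Fin m ⊕ Fin m → ℤ} (hr : symplecticForm g r = 0) : f r = 0 := by
  by_cases hrg : g + r = 0
  · rwa [eq_neg_of_add_eq_zero_right hrg]
  obtain ⟨s, h₁, h₂⟩ := exists_symplecticForm_ne_zero₂ hg hrg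
  rw [symplecticForm_add_left] at h₂
  have e₁ := hf.apply_add r s
  have e₂ := hf.apply_add r ((2 : ℤ) • s)
  have e₃ := hf.apply_add s (s + r)
  have e₄ := hf.apply_zsmul h₁ 2
  rw [show s + (s + r) = r + (2 : ℤ) • s by rw [two_smul]; abel, add_comm s r] at e₃
  simp only [symplecticForm_add_right, symplecticForm_smul_right, symplecticForm_self,
    symplecticForm_swap r s, hr] at e₁ e₂ e₃
  have h₁' : (symplecticForm g s : K) ≠ 0 := by exact_mod_cast h₁
  have h₂' : (symplecticForm g s + symplecticForm r s : K) ≠ 0 := by exact_mod_cast h₂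
  push_cast at e₁ e₂ e₃ e₄
  rw [e₄] at e₂
  have key : (symplecticForm g s : K) * ((symplecticForm g s + symplecticForm r s : K) * f r) =
      0 := by
    apply mul_left_cancel₀ (two_ne_zero (α := K))
    linear_combination (symplecticForm r s : K) * e₂ + 2 * (symplecticForm r s : K) * e₃ +
      (-2 * (symplecticForm r s + symplecticForm g s : K)) * e₁
  simpa [h₁', h₂'] using key

theorem exists_eq_mul (hf : IsHomogeneousCocycle g f) (hg : g ≠ 0) (h₀ : f (-g) = 0) :
    ∃ c : K, ∀ r, f r = c * symplecticForm g r := by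
  have trans : ∀ r s, symplecticForm g r = 0 → symplecticForm g s ≠ 0 → f (r + s) = f s := by
    intro r s hr hs
    have hs' : (symplecticForm g s : K) ≠ 0 := by exact_mod_cast hs
    by_cases h : symplecticForm r s = 0
    · have := hf.mul_comm_of_form_eq_zero (r := r + s) (s := s) (by
        simp [symplecticForm_add_left, h])
      rw [symplecticForm_add_right, hr, zero_add] at this
      exact mul_left_cancel₀ hs' this
    · have := hf.apply_add r s
      rw [hf.apply_eq_zero hg h₀ hr, hr] at this
      have h' : (symplecticForm r s : K) ≠ 0 := by exact_mod_cast h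
      apply mul_left_cancel₀ h'
      push_cast at this
      linear_combination this
  have hs := symplecticForm_bar_ne_zero hg
  generalize symplecticBar g = s at hs
  have hs' : (symplecticForm g s : K) ≠ 0 := by exact_mod_cast hs
  refine ⟨f s / symplecticForm g s, fun r => ?_⟩
  by_cases hr : symplecticForm g r = 0
  · simp [hf.apply_eq_zero hg h₀ hr, hr]
  have h₁ := trans (symplecticForm g s • r - symplecticForm g r • s) (symplecticForm g r • s)
    (by rw [sub_eq_add_neg, ← neg_smul, symplecticForm_add_right, symplecticForm_smul_right,
          symplecticForm_smul_right]; ring)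
    (by rw [symplecticForm_smul_right]; exact mul_ne_zero hr hs)
  rw [sub_add_cancel, hf.apply_zsmul hr, hf.apply_zsmul hs] at h₁
  field_simp
  linear_combination h₁

theorem map_add_of_degree_zero (hf : IsHomogeneousCocycle 0 f) (h₀ : f 0 = 0)
    (r s : Fin m ⊕ Fin m → ℤ) : f (r + s) = f r + f s := by
  have gen : ∀ r s, symplecticForm r s ≠ 0 → f (r + s) = f r + f s := by
    intro r s h
    have h' : (symplecticForm r s : K) ≠ 0 := by exact_mod_cast h
    have := hf.apply_add r s
    simp only [symplecticForm_zero_left, Int.cast_zero, add_zero, sub_zero] at this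
    apply mul_left_cancel₀ h'
    rw [this, mul_add]
  by_cases h : symplecticForm r s = 0
  swap
  · exact gen r s h
  by_cases hr : r = 0
  · simp [hr, h₀]
  by_cases hs : s = 0
  · simp [hs, h₀]
  by_cases hrs : r + s = 0
  · obtain ⟨t, ht, -⟩ := exists_symplecticForm_ne_zero₂ hr hs
    have h₁ := gen r t ht
    have h₂ := gen s (r + t) (by
      rw [eq_neg_of_add_eq_zero_right hrs, ← neg_one_smul ℤ r,
        symplecticForm_smul_left, symplecticForm_add_right, symplecticForm_self]
      simpa using ht)
    rw [← add_assoc, add_comm s r, hrs, zero_add, h₁] at h₂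
    rw [hrs, h₀]
    linear_combination h₂
  · obtain ⟨t, h₁, h₂, h₃⟩ := exists_symplecticForm_ne_zero₃ hr hs hrs
    have e₁ := gen _ _ h₂
    have e₂ := gen _ _ h₃
    have e₃ := gen r (s + t) (by rwa [symplecticForm_add_right, h, zero_add])
    rw [← add_assoc, e₂, e₁] at e₃
    linear_combination e₃

theorem exists_eq_sum (hf : IsHomogeneousCocycle 0 f) (h₀ : f 0 = 0) :
    ∃ u : Fin m ⊕ Fin m → K, ∀ r, f r = ∑ i, u i * ((r i : ℤ) : K) := by
  let F : (Fin m ⊕ Fin m → ℤ) →+ K := ⟨⟨f, h₀⟩, hf.map_add_of_degree_zero h₀⟩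
  refine ⟨fun i => F (Pi.single i 1), fun r => ?_⟩
  change F r = _
  conv_lhs => rw [← Finset.univ_sum_single r, map_sum]
  refine Finset.sum_congr rfl fun i _ => ?_
  rw [show Pi.single i (r i) = r i • (Pi.single i 1 : Fin m ⊕ Fin m → ℤ) by
    rw [← Pi.single_smul, smul_eq_mul, mul_one], map_zsmul, zsmul_eq_mul, mul_comm]

end IsHomogeneousCocycle

end FunctionalEquation

section Span

variable {K L : Type*} [CommRing K] [LieRing L] [LieAlgebra K L] {S : Set L}

theorem lie_mem_of_mem_span {N : Submodule K L} (h : ∀ x ∈ S, ∀ y ∈ S, ⁅x, y⁆ ∈ N) {x y : L}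
    (hx : x ∈ Submodule.span K S) (hy : y ∈ Submodule.span K S) : ⁅x, y⁆ ∈ N := by
  induction hx, hy using Submodule.span_induction₂ with
  | mem_mem x y hx hy => exact h x hx y hy
  | zero_left y hy => simp
  | zero_right x hx => simp
  | add_left x y z _ _ _ h₁ h₂ => rw [add_lie]; exact add_mem h₁ h₂
  | add_right x y z _ _ _ h₁ h₂ => rw [lie_add]; exact add_mem h₁ h₂
  | smul_left r x y _ _ h => rw [smul_lie]; exact Submodule.smul_mem _ _ h
  | smul_right r x y _ _ h => rw [lie_smul]; exact Submodule.smul_mem _ _ h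

theorem map_lie_eq_of_mem_span (φ ψ : L →ₗ[K] K) (y : L) (c : K)
    (h : ∀ x ∈ S, φ ⁅x, y⁆ = c * ψ x) {x : L} (hx : x ∈ Submodule.span K S) :
    φ ⁅x, y⁆ = c * ψ x := by
  induction hx using Submodule.span_induction with
  | mem x hx => exact h x hx
  | zero => simp
  | add x y _ _ hx hy => rw [add_lie, map_add, hx, hy, map_add, mul_add]
  | smul a x _ hx =>
    rw [smul_lie, map_smul, hx, map_smul, smul_eq_mul, smul_eq_mul]
    ring

end Span

section Coordinates

variable {K : Type*} [Field K] {m : ℕ}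

theorem vectorField_add {ι : Type*} [Fintype ι] (u v : ι → K) (r : ι → ℤ) :
    vectorField (u + v) r = vectorField u r + vectorField v r := by
  simp [vectorField, add_smul, Finset.sum_add_distrib]

theorem vectorField_smul {ι : Type*} [Fintype ι] (c : K) (u : ι → K) (r : ι → ℤ) :
    vectorField (c • u) r = c • vectorField u r := by
  simp [vectorField, mul_smul, Finset.smul_sum]

theorem vectorField_zero {ι : Type*} [Fintype ι] (r : ι → ℤ) :
    vectorField (0 : ι → K) r = 0 := by
  simp [vectorField]

theorem hamVec_zero : hamVec K (0 : Fin m ⊕ Fin m → ℤ) = 0 := by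
  rw [hamVec, show (fun i => ((symplecticBar (0 : Fin m ⊕ Fin m → ℤ) i : ℤ) : K)) = 0 by
    funext i; rcases i with i | i <;> simp [symplecticBar], vectorField_zero]

theorem lie_hamVec_hamVec (r s : Fin m ⊕ Fin m → ℤ) :
    ⁅hamVec K r, hamVec K s⁆ = (symplecticForm r s : K) • hamVec K (r + s) :=
  lie_hamVec K r s

/-- The coefficient of `h r` in an element of the Hamiltonian Lie algebra, for `r ≠ 0`; it is zero
for `r = 0`. -/
noncomputable def hamCoord (r : Fin m ⊕ Fin m → ℤ) : WittAlg K (Fin m ⊕ Fin m) →ₗ[K] K where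
  toFun x := (x (AddMonoidAlgebra.single (symplecticBar r) 1)).coeff (r + symplecticBar r) /
    (symplecticForm r (symplecticBar r) : K)
  map_add' x y := by simp [add_div]
  map_smul' c x := by simp [mul_div_assoc]

theorem hamCoord_vectorField (r s : Fin m ⊕ Fin m → ℤ) (u : Fin m ⊕ Fin m → K) :
    hamCoord r (vectorField u s) = if s = r then
      (∑ i, u i * ((symplecticBar r i : ℤ) : K)) / (symplecticForm r (symplecticBar r) : K)
      else 0 := by
  simp only [hamCoord, LinearMap.coe_mk, AddHom.coe_mk, vectorField_single, mul_one,
    AddMonoidAlgebra.coeff_single, Finsupp.single_apply, add_left_inj]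
  split_ifs <;> simp

theorem hamCoord_zero (x : WittAlg K (Fin m ⊕ Fin m)) : hamCoord 0 x = 0 := by
  simp [hamCoord]

variable [CharZero K]

theorem hamCoord_hamVec (r s : Fin m ⊕ Fin m → ℤ) :
    hamCoord r (hamVec K s) = if s = r ∧ r ≠ 0 then 1 else 0 := by
  rw [hamVec, hamCoord_vectorField]
  by_cases hr : r = 0
  · simp [hr]
  by_cases hs : s = r
  · have h : (symplecticForm r (symplecticBar r) : K) ≠ 0 := by
      exact_mod_cast symplecticForm_bar_ne_zero hr
    subst hs
    rw [if_pos rfl, if_pos ⟨rfl, hr⟩, div_eq_one_iff_eq h]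
    simp [symplecticForm]
  · simp [hs]

theorem hamCoord_linearCombination {r : Fin m ⊕ Fin m → ℤ} (hr : r ≠ 0)
    (c : (Fin m ⊕ Fin m → ℤ) →₀ K) :
    hamCoord r (Finsupp.linearCombination K (hamVec K) c) = c r := by
  classical
  rw [Finsupp.linearCombination_apply, map_finsuppSum]
  simpa [hamCoord_hamVec, hr, Finsupp.sum_ite_eq'] using Eq.symm

theorem finite_support_hamCoord {x : WittAlg K (Fin m ⊕ Fin m)}
    (hx : x ∈ Submodule.span K (Set.range (hamVec (m := m) K))) :
    {r | hamCoord r x ≠ 0}.Finite := by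
  obtain ⟨c, rfl⟩ := (Finsupp.mem_span_range_iff_exists_finsupp).1 hx
  refine c.support.finite_toSet.subset fun r h => ?_
  have hr : r ≠ 0 := by
    rintro rfl
    exact h (hamCoord_zero _)
  have h₂ := hamCoord_linearCombination hr c
  rw [Finsupp.linearCombination_apply] at h₂
  rw [Set.mem_ofPred_eq, h₂] at h
  exact Finsupp.mem_support_iff.2 h

theorem ext_hamCoord {x y : WittAlg K (Fin m ⊕ Fin m)}
    (hx : x ∈ Submodule.span K (Set.range (hamVec (m := m) K)))
    (hy : y ∈ Submodule.span K (Set.range (hamVec (m := m) K)))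
    (h : ∀ r, hamCoord r x = hamCoord r y) : x = y := by
  obtain ⟨c, hc⟩ := (Finsupp.mem_span_range_iff_exists_finsupp).1 (sub_mem hx hy)
  rw [← sub_eq_zero, ← hc]
  refine Finset.sum_eq_zero fun r _ => ?_
  by_cases hr : r = 0
  · simp [hr, hamVec_zero]
  have h₂ := hamCoord_linearCombination hr c
  rw [Finsupp.linearCombination_apply, hc, map_sub, h, sub_self] at h₂
  simp [← h₂]

theorem hamCoord_lie_hamVec {x : WittAlg K (Fin m ⊕ Fin m)}
    (hx : x ∈ Submodule.span K (Set.range (hamVec (m := m) K))) (r s : Fin m ⊕ Fin m → ℤ) :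
    hamCoord r ⁅x, hamVec K s⁆ = (symplecticForm r s : K) * hamCoord (r - s) x := by
  refine map_lie_eq_of_mem_span _ _ _ _ ?_ hx
  rintro _ ⟨t, rfl⟩
  rw [lie_hamVec_hamVec, map_smul, hamCoord_hamVec, hamCoord_hamVec, smul_eq_mul]
  by_cases h : t + s = r
  · subst h
    rw [symplecticForm_add_left, symplecticForm_self, add_zero, add_sub_cancel_right]
    by_cases h₁ : t = 0
    · simp [h₁]
    by_cases h₂ : t + s = 0
    · rw [eq_neg_of_add_eq_zero_right h₂, ← neg_one_smul ℤ t, symplecticForm_smul_right]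
      simp
    · simp [h₁, h₂]
  · rw [if_neg (fun h' => h h'.1), if_neg (fun h' => h (eq_sub_iff_add_eq.1 h'.1))]
    simp

end Coordinates

section Derived

variable {K : Type*} [Field K] {m : ℕ}

theorem hamVec_mem_ham (r : Fin m ⊕ Fin m → ℤ) : hamVec K r ∈ Ham K m :=
  Submodule.subset_span (Or.inl ⟨r, rfl⟩)

theorem cartan_mem_ham (u : Fin m ⊕ Fin m → K) : vectorField u 0 ∈ Ham K m :=
  Submodule.subset_span (Or.inr ⟨u, rfl⟩)

theorem mem_ham_of_mem_span {x : WittAlg K (Fin m ⊕ Fin m)}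
    (hx : x ∈ Submodule.span K (Set.range (hamVec (m := m) K))) : x ∈ Ham K m :=
  Submodule.span_mono Set.subset_union_left hx

theorem exists_eq_add_cartan {x : WittAlg K (Fin m ⊕ Fin m)} (hx : x ∈ Ham K m) :
    ∃ y ∈ Submodule.span K (Set.range (hamVec (m := m) K)), ∃ u, x = y + vectorField u 0 := by
  change x ∈ Submodule.span K (hamSpanSet K m) at hx
  induction hx using Submodule.span_induction with
  | mem x hx =>
    rcases hx with hx | ⟨u, rfl⟩
    · exact ⟨x, Submodule.subset_span hx, 0, by rw [vectorField_zero, add_zero]⟩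
    · exact ⟨0, zero_mem _, u, by simp⟩
  | zero => exact ⟨0, zero_mem _, 0, by rw [vectorField_zero, add_zero]⟩
  | add x y _ _ hx hy =>
    obtain ⟨x, hx, u, rfl⟩ := hx
    obtain ⟨y, hy, v, rfl⟩ := hy
    exact ⟨x + y, add_mem hx hy, u + v, by rw [vectorField_add]; abel⟩
  | smul c x _ hx =>
    obtain ⟨x, hx, u, rfl⟩ := hx
    exact ⟨c • x, Submodule.smul_mem _ _ hx, c • u, by rw [vectorField_smul, smul_add]⟩

theorem lie_mem_span_hamVec {x y : WittAlg K (Fin m ⊕ Fin m)} (hx : x ∈ Ham K m)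
    (hy : y ∈ Ham K m) : ⁅x, y⁆ ∈ Submodule.span K (Set.range (hamVec (m := m) K)) := by
  have key : ∀ r, hamVec K r ∈ Submodule.span K (Set.range (hamVec (m := m) K)) :=
    fun r => Submodule.subset_span ⟨r, rfl⟩
  refine lie_mem_of_mem_span ?_ hx hy
  rintro x (⟨r, rfl⟩ | ⟨u, rfl⟩) y (⟨s, rfl⟩ | ⟨v, rfl⟩)
  · simp only [lie_hamVec]
    exact Submodule.smul_mem _ _ (key _)
  · rw [← lie_skew]
    simp only [lie_cartan_hamVec]
    exact Submodule.neg_mem _ (Submodule.smul_mem _ _ (key _))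
  · simp only [lie_cartan_hamVec]
    exact Submodule.smul_mem _ _ (key _)
  · simp [lie_vectorField, vectorField_zero]

theorem coe_mem_span_hamVec (x : HamDerived K m) :
    ((x : Ham K m) : WittAlg K (Fin m ⊕ Fin m)) ∈
      Submodule.span K (Set.range (hamVec (m := m) K)) := by
  suffices h : ∀ x ∈ (HamDerived K m).toSubmodule, (x : WittAlg K (Fin m ⊕ Fin m)) ∈
      Submodule.span K (Set.range (hamVec (m := m) K)) from h x.1 x.2
  intro x hx
  rw [LieSubmodule.lieIdeal_oper_eq_linear_span'] at hx
  induction hx using Submodule.span_induction with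
  | mem x hx =>
    obtain ⟨y, -, z, -, rfl⟩ := hx
    exact lie_mem_span_hamVec y.2 z.2
  | zero => exact zero_mem _
  | add x y _ _ hx hy => exact add_mem hx hy
  | smul c x _ hx => exact Submodule.smul_mem _ c hx

variable (K) in
/-- The Hamiltonian vector field `h r` as an element of the Hamiltonian Lie algebra. -/
noncomputable def hamElem (r : Fin m ⊕ Fin m → ℤ) : Ham K m :=
  ⟨hamVec K r, hamVec_mem_ham r⟩

/-- The element `D(u, 0)` of the Cartan subalgebra of the Hamiltonian Lie algebra. -/
noncomputable def hamCartan (u : Fin m ⊕ Fin m → K) : Ham K m :=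
  ⟨vectorField u 0, cartan_mem_ham u⟩

theorem lie_hamElem (r s : Fin m ⊕ Fin m → ℤ) :
    ⁅hamElem K r, hamElem K s⁆ = (symplecticForm r s : K) • hamElem K (r + s) :=
  Subtype.ext (lie_hamVec K r s)

theorem lie_hamCartan_hamElem (u : Fin m ⊕ Fin m → K) (s : Fin m ⊕ Fin m → ℤ) :
    ⁅hamCartan u, hamElem K s⁆ = (∑ i, u i * ((s i : ℤ) : K)) • hamElem K s :=
  Subtype.ext (lie_cartan_hamVec K u s)

variable [CharZero K]

theorem hamElem_mem_hamDerived (r : Fin m ⊕ Fin m → ℤ) : hamElem K r ∈ HamDerived K m := by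
  by_cases hr : r = 0
  · rw [show hamElem K r = 0 from Subtype.ext (by rw [hr]; exact hamVec_zero)]
    exact zero_mem _
  · obtain ⟨i, hi⟩ := Function.ne_iff.1 hr
    have hi' : ((r i : ℤ) : K) ≠ 0 := by exact_mod_cast hi
    have h := lie_hamCartan_hamElem (Pi.single i (1 : K)) r
    rw [Finset.sum_eq_single i (fun j _ hj => by simp [Pi.single_eq_of_ne hj]) (by simp),
      Pi.single_eq_same, one_mul] at h
    rw [← inv_smul_smul₀ hi' (hamElem K r), ← h]
    exact (HamDerived K m).smul_mem _
      (LieSubmodule.lie_mem_lie (LieSubmodule.mem_top _) (LieSubmodule.mem_top _))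

variable (K) in
/-- The Hamiltonian vector field `h r` as an element of the derived algebra. -/
noncomputable def hamDerivedElem (r : Fin m ⊕ Fin m → ℤ) : HamDerived K m :=
  ⟨hamElem K r, hamElem_mem_hamDerived r⟩

theorem lie_hamDerivedElem (r s : Fin m ⊕ Fin m → ℤ) :
    ⁅hamDerivedElem K r, hamDerivedElem K s⁆ =
      (symplecticForm r s : K) • hamDerivedElem K (r + s) :=
  Subtype.ext (lie_hamElem r s)

theorem span_range_hamDerivedElem :
    Submodule.span K (Set.range (hamDerivedElem (m := m) K)) = ⊤ := by
  rw [eq_top_iff]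
  rintro x -
  obtain ⟨c, hc⟩ := (Finsupp.mem_span_range_iff_exists_finsupp).1 (coe_mem_span_hamVec x)
  refine (Finsupp.mem_span_range_iff_exists_finsupp).2 ⟨c, ?_⟩
  let incl : HamDerived K m →ₗ[K] WittAlg K (Fin m ⊕ Fin m) :=
    (Ham K m).toSubmodule.subtype ∘ₗ (HamDerived K m).toSubmodule.subtype
  have hincl : Function.Injective incl := Subtype.val_injective.comp Subtype.val_injective
  apply hincl
  rw [map_finsuppSum]
  simp only [map_smul]
  exact hc

/-- The centralizer of the derived algebra in the Hamiltonian Lie algebra is trivial. -/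
theorem eq_zero_of_lie_hamElem_eq_zero {x : Ham K m}
    (h : ∀ r : Fin m ⊕ Fin m → ℤ, ⁅x, hamElem K r⁆ = 0) : x = 0 := by
  obtain ⟨y, hy, u, hx⟩ := exists_eq_add_cartan x.2
  obtain rfl : x = ⟨y, mem_ham_of_mem_span hy⟩ + hamCartan u := Subtype.ext hx
  have h₁ : ∀ s, ⁅y, hamVec K s⁆ = -((∑ i, u i * ((s i : ℤ) : K)) • hamVec K s) := by
    intro s
    have := h s
    rw [add_lie, lie_hamCartan_hamElem] at this
    exact congrArg Subtype.val (eq_neg_of_add_eq_zero_left this)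
  have h₂ : ∀ r s, (symplecticForm r s : K) * hamCoord (r - s) y =
      -((∑ i, u i * ((s i : ℤ) : K)) * if s = r ∧ r ≠ 0 then 1 else 0) := by
    intro r s
    rw [← hamCoord_lie_hamVec hy, h₁, map_neg, map_smul, hamCoord_hamVec, smul_eq_mul]
  have hu : u = 0 := by
    funext i
    have hi : (Pi.single i 1 : Fin m ⊕ Fin m → ℤ) ≠ 0 := by simp
    have h₃ := h₂ (Pi.single i 1) (Pi.single i 1)
    rw [if_pos ⟨rfl, hi⟩, symplecticForm_self, Finset.sum_eq_single i
      (fun j _ hj => by simp [Pi.single_eq_of_ne hj]) (by simp), Pi.single_eq_same] at h₃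
    simpa using h₃
  subst hu
  have hy₀ : y = 0 := by
    refine ext_hamCoord hy (zero_mem _) fun r => ?_
    by_cases hr : r = 0
    · rw [hr, hamCoord_zero, hamCoord_zero]
    have h₃ := h₂ (r + symplecticBar r) (symplecticBar r)
    have h₄ : (symplecticForm r (symplecticBar r) : K) ≠ 0 := by
      exact_mod_cast symplecticForm_bar_ne_zero hr
    rw [add_sub_cancel_right, symplecticForm_add_left, symplecticForm_self, add_zero] at h₃
    rw [map_zero]
    simpa [h₄] using h₃
  subst hy₀
  apply Subtype.ext
  change 0 + vectorField (0 : Fin m ⊕ Fin m → K) 0 = (0 : WittAlg K (Fin m ⊕ Fin m))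
  rw [vectorField_zero, add_zero]

end Derived

section Derivations

variable {K : Type*} [Field K] [CharZero K] {m : ℕ}

/-- The coefficient of `h (r + g)` in `D (h r)`. -/
noncomputable def derivationCoeff (D : LieDerivation K (HamDerived K m) (HamDerived K m))
    (g r : Fin m ⊕ Fin m → ℤ) : K :=
  hamCoord (r + g) ((D (hamDerivedElem K r) : Ham K m) : WittAlg K (Fin m ⊕ Fin m))

theorem isHomogeneousCocycle_derivationCoeff
    (D : LieDerivation K (HamDerived K m) (HamDerived K m)) (g : Fin m ⊕ Fin m → ℤ) :
    IsHomogeneousCocycle g (derivationCoeff D g) := by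
  intro r s
  have h₁ := D.apply_lie_eq_sub (hamDerivedElem K r) (hamDerivedElem K s)
  rw [lie_hamDerivedElem, map_smul, ← lie_skew, ← lie_skew (hamDerivedElem K s)] at h₁
  have h₂ : (symplecticForm r s : K) •
      ((D (hamDerivedElem K (r + s)) : Ham K m) : WittAlg K (Fin m ⊕ Fin m)) =
      -⁅((D (hamDerivedElem K s) : Ham K m) : WittAlg K (Fin m ⊕ Fin m)), hamVec K r⁆ -
      -⁅((D (hamDerivedElem K r) : Ham K m) : WittAlg K (Fin m ⊕ Fin m)), hamVec K s⁆ :=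
    congrArg (fun x : HamDerived K m => ((x : Ham K m) : WittAlg K (Fin m ⊕ Fin m))) h₁
  have h₃ := congrArg (hamCoord (r + s + g)) h₂
  rw [map_smul, map_sub, map_neg, map_neg, hamCoord_lie_hamVec (coe_mem_span_hamVec _),
    hamCoord_lie_hamVec (coe_mem_span_hamVec _), smul_eq_mul,
    show r + s + g - r = s + g by abel, show r + s + g - s = r + g by abel] at h₃
  simp only [derivationCoeff]
  rw [h₃, show r + s + g = r + g + s by abel, symplecticForm_add_left (r + g) s s,
    symplecticForm_self, add_zero, show r + g + s = (s + g) + r by abel,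
    symplecticForm_add_left (s + g) r r, symplecticForm_self, add_zero,
    symplecticForm_swap r (s + g)]
  push_cast
  ring

theorem derivationCoeff_neg (D : LieDerivation K (HamDerived K m) (HamDerived K m))
    (g : Fin m ⊕ Fin m → ℤ) : derivationCoeff D g (-g) = 0 := by
  rw [derivationCoeff, neg_add_cancel, hamCoord_zero]

/-- Every derivation of the derived algebra is the restriction of an inner derivation of the
Hamiltonian Lie algebra. -/
theorem exists_eq_lie (D : LieDerivation K (HamDerived K m) (HamDerived K m)) :
    ∃ x : Ham K m, ∀ y : HamDerived K m, (D y : Ham K m) = ⁅x, (y : Ham K m)⁆ := by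
  have hc : ∀ g, ∃ c : K, g ≠ 0 → ∀ r, derivationCoeff D g r = c * symplecticForm g r := by
    intro g
    by_cases hg : g = 0
    · exact ⟨0, fun h => absurd hg h⟩
    · obtain ⟨c, hc⟩ := (isHomogeneousCocycle_derivationCoeff D g).exists_eq_mul hg
        (derivationCoeff_neg D g)
      exact ⟨c, fun _ => hc⟩
  choose c hc using hc
  obtain ⟨u, hu⟩ := (isHomogeneousCocycle_derivationCoeff D 0).exists_eq_sum
    (by simpa using derivationCoeff_neg D 0)
  have hfin : {g | g ≠ 0 ∧ c g ≠ 0}.Finite := by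
    have h₁ : ∀ i, {g | derivationCoeff D g (Pi.single i 1) ≠ 0}.Finite := fun i =>
      (finite_support_hamCoord (coe_mem_span_hamVec (D (hamDerivedElem K (Pi.single i 1))))).preimage
        (add_right_injective (Pi.single i 1)).injOn
    refine (Set.finite_iUnion h₁).subset ?_
    rintro g ⟨hg, hcg⟩
    rw [Set.mem_iUnion]
    by_contra! h
    have h₂ : ∀ i, symplecticForm g (Pi.single i 1) = 0 := by
      intro i
      have h₃ : ¬ derivationCoeff D g (Pi.single i 1) ≠ 0 := h i
      rw [not_not, hc g hg, mul_eq_zero, or_iff_right hcg] at h₃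
      exact_mod_cast h₃
    apply symplecticForm_bar_ne_zero hg
    simp only [symplecticForm, Pi.single_apply, mul_ite, mul_one, mul_zero, Finset.sum_ite_eq',
      Finset.mem_univ, if_true] at h₂
    simp [symplecticForm, h₂]
  let a : (Fin m ⊕ Fin m → ℤ) →₀ K := Finsupp.onFinset hfin.toFinset
    (fun g => if g = 0 then 0 else c g) (by
      intro g hg
      simpa using hg)
  have ha : ∀ g, g ≠ 0 → a g = c g := fun g hg => if_neg hg
  have hmem : Finsupp.linearCombination K (hamVec K) a ∈
      Submodule.span K (Set.range (hamVec (m := m) K)) :=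
    (Finsupp.mem_span_range_iff_exists_finsupp).2 ⟨a, rfl⟩
  let z : Ham K m := ⟨_, mem_ham_of_mem_span hmem⟩
  refine ⟨z + hamCartan u, fun y => ?_⟩
  let incl : HamDerived K m →ₗ[K] Ham K m := (HamDerived K m).toSubmodule.subtype
  suffices h : incl ∘ₗ (D : HamDerived K m →ₗ[K] HamDerived K m) =
      (LieAlgebra.ad K (Ham K m) (z + hamCartan u)) ∘ₗ incl from LinearMap.congr_fun h y
  refine LinearMap.ext_on_range span_range_hamDerivedElem fun r => ?_
  change (D (hamDerivedElem K r) : Ham K m) = ⁅z + hamCartan u, hamElem K r⁆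
  rw [add_lie, lie_hamCartan_hamElem]
  apply Subtype.ext
  change _ = ⁅Finsupp.linearCombination K (hamVec K) a, hamVec K r⁆ +
    (∑ i, u i * ((r i : ℤ) : K)) • hamVec K r
  refine ext_hamCoord (coe_mem_span_hamVec _) (add_mem (lie_mem_span_hamVec z.2 (hamVec_mem_ham r))
    (Submodule.smul_mem _ _ (Submodule.subset_span ⟨r, rfl⟩))) fun s => ?_
  rw [map_add, hamCoord_lie_hamVec hmem, map_smul, hamCoord_hamVec, smul_eq_mul]
  obtain ⟨g, rfl⟩ : ∃ g, s = r + g := ⟨s - r, by abel⟩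
  change derivationCoeff D g r = _
  rw [add_sub_cancel_left]
  by_cases hg : g = 0
  · subst hg
    rw [hu, hamCoord_zero, mul_zero, zero_add, add_zero]
    by_cases hr : r = 0 <;> simp [hr]
  · rw [hamCoord_linearCombination hg, ha g hg, hc g hg, symplecticForm_add_left,
      symplecticForm_self, zero_add, if_neg (fun h => hg (by simpa using h.1)), mul_zero, add_zero,
      mul_comm]

end Derivations

section Restriction

variable {K L : Type*} [CommRing K] [LieRing L] [LieAlgebra K L]

theorem LieDerivation.apply_mem_derived (D : LieDerivation K L L) {x : L}
    (hx : x ∈ ⁅(⊤ : LieIdeal K L), (⊤ : LieIdeal K L)⁆) :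
    D x ∈ ⁅(⊤ : LieIdeal K L), (⊤ : LieIdeal K L)⁆ := by
  have key : ∀ y z : L, ⁅y, z⁆ ∈ ⁅(⊤ : LieIdeal K L), (⊤ : LieIdeal K L)⁆ := fun y z =>
    LieSubmodule.lie_mem_lie (LieSubmodule.mem_top _) (LieSubmodule.mem_top _)
  change x ∈ (⁅(⊤ : LieIdeal K L), (⊤ : LieIdeal K L)⁆ : LieIdeal K L).toSubmodule at hx
  rw [LieSubmodule.lieIdeal_oper_eq_linear_span'] at hx
  induction hx using Submodule.span_induction with
  | mem x hx =>
    obtain ⟨y, -, z, -, rfl⟩ := hx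
    rw [D.apply_lie_eq_add]
    exact add_mem (key _ _) (key _ _)
  | zero => rw [map_zero]; exact zero_mem _
  | add x y _ _ hx hy => rw [map_add]; exact add_mem hx hy
  | smul c x _ hx => rw [map_smul]; exact Submodule.smul_mem _ c hx

/-- Restriction of derivations of a Lie algebra to its derived algebra. -/
def LieDerivation.restrictDerived :
    LieDerivation K L L →ₗ⁅K⁆
      LieDerivation K (⁅(⊤ : LieIdeal K L), (⊤ : LieIdeal K L)⁆ : LieIdeal K L)
        (⁅(⊤ : LieIdeal K L), (⊤ : LieIdeal K L)⁆ : LieIdeal K L) where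
  toFun D :=
    { toFun := fun x => ⟨D x, D.apply_mem_derived x.2⟩
      map_add' := fun x y => Subtype.ext (map_add D (x : L) (y : L))
      map_smul' := fun c x => Subtype.ext (map_smul D c (x : L))
      leibniz' := fun x y => Subtype.ext (D.apply_lie_eq_sub (x : L) (y : L)) }
  map_add' _ _ := rfl
  map_smul' _ _ := rfl
  map_lie' := rfl

theorem LieDerivation.coe_restrictDerived_apply (D : LieDerivation K L L)
    (x : (⁅(⊤ : LieIdeal K L), (⊤ : LieIdeal K L)⁆ : LieIdeal K L)) :
    (LieDerivation.restrictDerived D x : L) = D x :=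
  rfl

end Restriction

section Completeness

variable {K : Type*} [Field K] [CharZero K] {m : ℕ}

theorem ham_derivation_ext {D E : LieDerivation K (Ham K m) (Ham K m)}
    (h : ∀ r, D (hamElem K r) = E (hamElem K r)) : D = E := by
  have hd : ∀ y : HamDerived K m, (D - E) (y : Ham K m) = 0 := by
    intro y
    let incl : HamDerived K m →ₗ[K] Ham K m := (HamDerived K m).toSubmodule.subtype
    suffices h₁ : ((D - E : LieDerivation K (Ham K m) (Ham K m)) : Ham K m →ₗ[K] Ham K m) ∘ₗ incl =
        0 from LinearMap.congr_fun h₁ y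
    refine LinearMap.ext_on_range span_range_hamDerivedElem fun r => ?_
    change (D - E) (hamElem K r) = 0
    rw [LieDerivation.sub_apply, h, sub_self]
  rw [← sub_eq_zero]
  ext1 x
  refine eq_zero_of_lie_hamElem_eq_zero fun r => ?_
  have h₁ := (D - E).apply_lie_eq_add x (hamElem K r)
  rw [hd ⟨_, (HamDerived K m).lie_mem (x := x) (hamElem_mem_hamDerived r)⟩,
    LieDerivation.sub_apply (a := hamElem K r), h, sub_self, lie_zero, zero_add] at h₁
  exact h₁.symm

theorem exists_restrictDerived_ad_eq (D : LieDerivation K (HamDerived K m) (HamDerived K m)) :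
    ∃ x : Ham K m, LieDerivation.restrictDerived (LieDerivation.ad K (Ham K m) x) = D := by
  obtain ⟨x, hx⟩ := exists_eq_lie D
  refine ⟨x, LieDerivation.ext fun y => Subtype.ext ?_⟩
  rw [LieDerivation.coe_restrictDerived_apply, hx, LieDerivation.ad_apply_apply]

theorem restrictDerived_injective : Function.Injective
    (LieDerivation.restrictDerived (K := K) (L := Ham K m)) := by
  intro D E h
  refine ham_derivation_ext fun r => ?_
  exact congrArg Subtype.val (LieDerivation.congr_fun h (hamDerivedElem K r))

theorem exists_ad_eq (D : LieDerivation K (Ham K m) (Ham K m)) :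
    ∃ x : Ham K m, LieDerivation.ad K (Ham K m) x = D := by
  obtain ⟨x, hx⟩ := exists_restrictDerived_ad_eq (LieDerivation.restrictDerived D)
  exact ⟨x, restrictDerived_injective hx⟩

theorem center_ham : LieAlgebra.center K (Ham K m) = ⊥ := by
  rw [LieSubmodule.eq_bot_iff]
  intro x hx
  refine eq_zero_of_lie_hamElem_eq_zero fun r => ?_
  rw [← lie_skew, (LieModule.mem_maxTrivSubmodule K _ _ x).1 hx, neg_zero]

theorem ad_ham_injective : Function.Injective (LieDerivation.ad K (Ham K m)) := by
  rw [injective_iff_map_eq_zero]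
  intro x hx
  refine eq_zero_of_lie_hamElem_eq_zero fun r => ?_
  rw [← LieDerivation.ad_apply_apply K, hx, LieDerivation.zero_apply]

end Completeness

theorem theorem4p6 (K : Type*) [Field K] [IsAlgClosed K] [CharZero K] (m : ℕ) (hm : 1 ≤ m) :
    -- every derivation is inner
    (∀ D : LieDerivation K (Ham K m) (Ham K m), ∃ x : Ham K m, D = LieDerivation.ad K (Ham K m) x) ∧
    -- the center is trivial
    LieAlgebra.center K (Ham K m) = ⊥ ∧
    -- the adjoint map is an isomorphism onto the derivation algebra
    (∃ e : Ham K m ≃ₗ⁅K⁆ LieDerivation K (Ham K m) (Ham K m),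
      ∀ x, e x = LieDerivation.ad K (Ham K m) x) ∧
    -- restriction identifies the derivations of the algebra and of its derived subalgebra
    (∃ ρ : LieDerivation K (Ham K m) (Ham K m) ≃ₗ⁅K⁆
        LieDerivation K (HamDerived K m) (HamDerived K m),
      ∀ D (y : HamDerived K m), ((ρ D y : HamDerived K m) : Ham K m) = D (y : Ham K m)) := by
  refine ⟨fun D => (exists_ad_eq D).imp fun _ h => h.symm, center_ham,
    ⟨LieEquiv.ofBijective (LieDerivation.ad K (Ham K m)) ⟨ad_ham_injective, exists_ad_eq⟩,
      fun _ => rfl⟩,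
    ⟨LieEquiv.ofBijective LieDerivation.restrictDerived ⟨restrictDerived_injective, fun D =>
      let ⟨x, hx⟩ := exists_restrictDerived_ad_eq D; ⟨_, hx⟩⟩, fun _ _ => rfl⟩⟩
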